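/- Let $G$ be a countably infinite discrete group. Let $\mathrm{Sub}_\infty(G)$ be the set of subgroups of $G$ of infinite index, with the topology induced by the product topology on $2^G$, where a subgroup is identified with its indicator function, and let $G$ act on $\mathrm{Sub}_\infty(G)$ by conjugation, $g\cdot H = gHg^{-1}$. This action is called topologically transitive if for any non-empty open sets $U,V\subseteq \mathrm{Sub}_\infty(G)$ there is $g\in G$ with $g(U)\cap V\neq\emptyset$. The group $G$ is called invariably generated if there is a subset $S\subseteq G$ such that, for every function $f\colon S\to G$, the set $\{f(s)^{-1}sf(s) \mid s\in S\}$ generates $G$. (1) If $G$ is invariably generated, then the action of $G$ on $\mathrm{Sub}_\infty(G)$ is topologically transitive if and only if $G\cong\mathbb{Z}$. (2) If $G$ is virtually solvable (that is, has a solvable subgroup of finite index), then the action of $G$ on $\mathrm{Sub}_\infty(G)$ is topologically transitive if and only if $G\cong\mathbb{Z}$. -/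

import Mathlib

/-- The product topology of `2^G`, with `2 = Bool` discrete, restricted to the set of subgroups of
`G`: a subgroup is identified with its indicator function. -/
noncomputable abbrev subgroupTopology (G : Type*) [Group G] : TopologicalSpace (Subgroup G) :=
  open scoped Classical in
  TopologicalSpace.induced (fun (H : Subgroup G) (g : G) => decide (g ∈ H)) inferInstance

/-- The set of subgroups of infinite index of `G`. -/
def SubInf (G : Type*) [Group G] : Type _ := {H : Subgroup G // ¬ H.FiniteIndex}

namespace SubInf

/-- The subspace topology. -/
noncomputable instance (G : Type*) [Group G] : TopologicalSpace (SubInf G) :=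
  TopologicalSpace.induced Subtype.val (subgroupTopology G)

/-- The image of a subgroup of infinite index under an automorphism has infinite index. -/
theorem not_finiteIndex_map {G : Type*} [Group G] (e : G ≃* G) {H : Subgroup G}
    (hH : ¬ H.FiniteIndex) : ¬ (H.map e.toMonoidHom).FiniteIndex := by
  rw [Subgroup.finiteIndex_iff] at hH ⊢
  rwa [MulEquiv.toMonoidHom_eq_coe, Subgroup.index_map_equiv]

/-- The conjugation action: `g • H = g H g⁻¹`. -/
instance (G : Type*) [Group G] : MulAction G (SubInf G) where
  smul g H := ⟨H.1.map (MulAut.conj g).toMonoidHom, not_finiteIndex_map _ H.2⟩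
  one_smul H := by
    refine Subtype.ext (Subgroup.ext fun x => ?_)
    change x ∈ H.1.map (MulAut.conj (1 : G)).toMonoidHom ↔ x ∈ H.1
    simp [Subgroup.mem_map]
  mul_smul g h H := by
    refine Subtype.ext ?_
    change H.1.map (MulAut.conj (g * h)).toMonoidHom =
      (H.1.map (MulAut.conj h).toMonoidHom).map (MulAut.conj g).toMonoidHom
    rw [Subgroup.map_map]
    congr 1
    ext x
    simp [mul_assoc]

end SubInf

/-- `G` is invariably generated: some subset `S` still generates `G` after each of its elements is
replaced by an arbitrary conjugate. -/
def IsInvariablyGenerated (G : Type*) [Group G] : Prop :=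
  ∃ S : Set G, ∀ f : S → G,
    Subgroup.closure (Set.range fun s : S => (f s)⁻¹ * (s : G) * f s) = ⊤

/-- `G` is virtually solvable: it has a solvable subgroup of finite index. -/
def IsVirtuallySolvable (G : Type*) [Group G] : Prop :=
  ∃ N : Subgroup G, Group.IsSolvable N ∧ N.FiniteIndex

/-! Both hypotheses on `G` imply that a subgroup meeting every conjugacy class is all of `G`.
Suppose that the action is transitive and every cyclic subgroup has infinite index. Then a conjugate
of any prescribed element can be adjoined to a finite set lying in an infinite-index subgroup that
avoids a fixed `x ≠ 1`. Running through the countable group `G` yields a subgroup that meets every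
class and misses `x`, a contradiction (`not_noProperSubgroupMeetsAllConjClasses`).

So `G` is virtually `ℤ`. Transitivity excludes nontrivial finite normal subgroups, which leaves `ℤ`
and the infinite dihedral group. The latter fails because it has two classes of reflections, and
reflections from different classes generate a subgroup of finite index. Conversely, `⊥` is the only
infinite-index subgroup of `ℤ`. -/

/-- No proper subgroup of `G` meets every conjugacy class. -/
def NoProperSubgroupMeetsAllConjClasses (G : Type*) [Group G] : Prop :=
  ∀ H : Subgroup G, (∀ g : G, ∃ k : G, k⁻¹ * g * k ∈ H) → H = ⊤

/-! ### Subgroups meeting every conjugacy class -/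

namespace NoProperSubgroupMeetsAllConjClasses

theorem of_isInvariablyGenerated {G : Type*} [Group G] (h : IsInvariablyGenerated G) :
    NoProperSubgroupMeetsAllConjClasses G := by
  obtain ⟨S, hS⟩ := h
  intro H hH
  choose f hf using hH
  rw [eq_top_iff, ← hS fun s => f s, Subgroup.closure_le]
  rintro _ ⟨s, rfl⟩
  exact hf s

/-- Jordan's theorem on derangements: the conjugates of a proper subgroup of a finite group do not
cover the group. -/
theorem of_finite {G : Type*} [Group G] [Finite G] : NoProperSubgroupMeetsAllConjClasses G := by
  classical
  intro H hH
  have := Fintype.ofFinite G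
  have := Fintype.ofFinite (G ⧸ H)
  have := Fintype.ofFinite (Quotient (MulAction.orbitRel G (G ⧸ H)))
  have hle : Fintype.card (Quotient (MulAction.orbitRel G (G ⧸ H))) ≤ 1 := by
    rw [Fintype.card_le_one_iff_subsingleton]
    exact (MulAction.pretransitive_iff_subsingleton_quotient G (G ⧸ H)).1 inferInstance
  -- Burnside: with one orbit, the average number of fixed points is 1. Yet every element fixes a
  -- coset, and `1` fixes `H.index` of them.
  have key := MulAction.sum_card_fixedBy_eq_card_orbits_mul_card_group G (G ⧸ H)
  have hpos (g : G) : 1 ≤ Fintype.card (MulAction.fixedBy (G ⧸ H) g) := by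
    obtain ⟨k, hk⟩ := hH g
    refine Fintype.card_pos_iff.2 ⟨⟨(k : G ⧸ H), ?_⟩⟩
    change ((g * k : G) : G ⧸ H) = (k : G ⧸ H)
    refine (QuotientGroup.eq.2 ?_).symm
    rwa [← mul_assoc]
  by_contra hne
  have h1 : 1 < Fintype.card (MulAction.fixedBy (G ⧸ H) (1 : G)) := by
    have : Fintype.card (MulAction.fixedBy (G ⧸ H) (1 : G)) = H.index := by
      rw [Subgroup.index, Nat.card_eq_fintype_card, Fintype.card_eq]
      exact ⟨(Equiv.setCongr (MulAction.fixedBy_one_eq_univ _ _)).trans (Equiv.Set.univ _)⟩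
    rw [this]
    have h0 : H.index ≠ 0 := Subgroup.FiniteIndex.index_ne_zero
    have h2 : H.index ≠ 1 := fun h => hne (Subgroup.index_eq_one.1 h)
    omega
  have hlt : ∑ _g : G, 1 < ∑ g : G, Fintype.card (MulAction.fixedBy (G ⧸ H) g) :=
    Finset.sum_lt_sum (fun g _ => hpos g) ⟨1, Finset.mem_univ _, h1⟩
  simp only [Finset.sum_const, Finset.card_univ, smul_eq_mul, mul_one] at hlt
  rw [key] at hlt
  nlinarith

/-- Once `H` and the `n`-th derived subgroup generate `G`, an element `d` of the latter is
conjugated into `H` by some `m` in that same derived subgroup. Modulo the next one, `m * d * m⁻¹` is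
just `d`. -/
theorem of_isSolvable {G : Type*} [Group G] [hG : Group.IsSolvable G] :
    NoProperSubgroupMeetsAllConjClasses G := by
  intro H hH
  have key (n : ℕ) : derivedSeries G n ⊔ H = ⊤ := by
    induction n with
    | zero => simp
    | succ n ih =>
      set K := derivedSeries G (n + 1) ⊔ H with hK
      have hHK : H ≤ K := le_sup_right
      have hle : derivedSeries G n ≤ K := by
        intro d hd
        obtain ⟨k, hk⟩ := hH d
        have hk' : k⁻¹ ∈ H ⊔ derivedSeries G n := by rw [sup_comm, ih]; trivial
        obtain ⟨h, hh, m, hm, hhm⟩ := Subgroup.mem_sup_of_normal_right.1 hk'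
        have hmd : m * d * m⁻¹ ∈ K := by
          have h1 : k⁻¹ * d * k = h * (m * d * m⁻¹) * h⁻¹ := by
            rw [← inv_inv k, inv_inv k⁻¹, ← hhm]; group
          have h2 := hHK hk
          rw [h1] at h2
          have := K.mul_mem (K.mul_mem (K.inv_mem (hHK hh)) h2) (hHK hh)
          simpa [mul_assoc] using this
        have hc : m * d * m⁻¹ * d⁻¹ ∈ K :=
          (le_sup_left : derivedSeries G (n + 1) ≤ K)
            (Subgroup.commutator_mem_commutator hm hd)
        have := K.mul_mem (K.inv_mem hc) hmd
        simpa [mul_assoc] using this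
      exact top_le_iff.1 (ih ▸ sup_le hle hHK)
  obtain ⟨n, hn⟩ := hG.solvable
  simpa [hn] using key n

/-- The quotient gives `G = H N`, so conjugators can be taken in `N`, and `H ∩ N` meets every class
of `N`. -/
theorem of_extension {G : Type*} [Group G] (N : Subgroup G) [N.Normal]
    (hN : NoProperSubgroupMeetsAllConjClasses N)
    (hQ : NoProperSubgroupMeetsAllConjClasses (G ⧸ N)) :
    NoProperSubgroupMeetsAllConjClasses G := by
  intro H hH
  have hHN : H ⊔ N = ⊤ := by
    have h1 : H.map (QuotientGroup.mk' N) = ⊤ := by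
      refine hQ _ fun q => ?_
      obtain ⟨g, rfl⟩ := QuotientGroup.mk'_surjective N q
      obtain ⟨k, hk⟩ := hH g
      exact ⟨QuotientGroup.mk' N k, k⁻¹ * g * k, hk, by simp⟩
    have h2 := congrArg (Subgroup.comap (QuotientGroup.mk' N)) h1
    rwa [Subgroup.comap_map_eq, QuotientGroup.ker_mk', Subgroup.comap_top] at h2
  have hle : N ≤ H := by
    refine Subgroup.subgroupOf_eq_top.1 (hN _ fun d => ?_)
    obtain ⟨k, hk⟩ := hH d
    have hk' : k⁻¹ ∈ H ⊔ N := by rw [hHN]; trivial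
    obtain ⟨h, hh, m, hm, hhm⟩ := Subgroup.mem_sup_of_normal_right.1 hk'
    refine ⟨⟨m⁻¹, N.inv_mem hm⟩, ?_⟩
    rw [Subgroup.mem_subgroupOf]
    have h1 : k⁻¹ * d * k = h * (m * d * m⁻¹) * h⁻¹ := by
      rw [← inv_inv k, inv_inv k⁻¹, ← hhm]; group
    rw [h1] at hk
    have := H.mul_mem (H.mul_mem (H.inv_mem hh) hk) hh
    simpa [mul_assoc] using this
  rw [← hHN, sup_eq_left.2 hle]

theorem of_isVirtuallySolvable {G : Type*} [Group G] (h : IsVirtuallySolvable G) :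
    NoProperSubgroupMeetsAllConjClasses G := by
  obtain ⟨N, hN, hfin⟩ := h
  have : Group.IsSolvable N.normalCore :=
    Group.isSolvable_of_isSolvable_injective (Subgroup.inclusion_injective N.normalCore_le)
  exact of_extension N.normalCore of_isSolvable of_finite

end NoProperSubgroupMeetsAllConjClasses

/-! ### Consequences of topological transitivity -/

namespace SubInf

theorem mem_smul_iff {G : Type*} [Group G] (g x : G) (K : SubInf G) :
    x ∈ (g • K).1 ↔ g⁻¹ * x * g ∈ K.1 := by
  change x ∈ K.1.map (MulAut.conj g).toMonoidHom ↔ _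
  constructor
  · rintro ⟨y, hy, rfl⟩
    simpa [mul_assoc] using hy
  · intro h
    exact ⟨_, h, by simp [mul_assoc]⟩

theorem isClopen_setOf_mem {G : Type*} [Group G] (g : G) : IsClopen {K : SubInf G | g ∈ K.1} := by
  classical
  have hc : Continuous fun K : SubInf G => decide (g ∈ K.1) := by
    have h1 : Continuous (fun (K : SubInf G) (g : G) => decide (g ∈ K.1)) := by
      let := subgroupTopology G
      have h2 : Continuous (fun K : SubInf G => K.1) := continuous_induced_dom
      have h3 : Continuous (fun (H : Subgroup G) (g : G) => decide (g ∈ H)) := by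
        convert! continuous_induced_dom
      exact h3.comp h2
    exact (continuous_apply g).comp h1
  have := (isClopen_discrete {true}).preimage hc
  convert this using 1
  ext K
  simp

theorem isOpen_setOf_subset {G : Type*} [Group G] {F : Set G} (hF : F.Finite) :
    IsOpen {K : SubInf G | F ⊆ K.1} := by
  have : {K : SubInf G | F ⊆ K.1} = ⋂ x ∈ F, {K : SubInf G | x ∈ K.1} := by
    ext K; simp [Set.subset_def]
  rw [this]
  exact hF.isOpen_biInter fun x _ => (isClopen_setOf_mem x).isOpen

theorem not_finiteIndex_of_finite {G : Type*} [Group G] [Infinite G] (N : Subgroup G) [Finite N] :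
    ¬ N.FiniteIndex := fun h =>
  not_finite_iff_infinite.2 ‹Infinite G›
    ((Subgroup.finite_iff_finite_and_finiteIndex N).2 ⟨inferInstance, h⟩)

section IsTopologicallyTransitive

variable {G : Type*} [Group G] [MulAction.IsTopologicallyTransitive G (SubInf G)]

/-- Two compatible conditions of membership are simultaneously satisfied up to conjugation. -/
theorem exists_conj {F F' : Set G} (hF : F.Finite) (hF' : F'.Finite) {x : G}
    (K : SubInf G) (hK : F ⊆ K.1) (hxK : x ∉ K.1) (K' : SubInf G) (hK' : F' ⊆ K'.1) :
    ∃ (g : G) (L : SubInf G), F ⊆ L.1 ∧ x ∉ L.1 ∧ ∀ y ∈ F', g * y * g⁻¹ ∈ L.1 := by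
  have hV : IsOpen ({L : SubInf G | F ⊆ L.1} ∩ {L : SubInf G | x ∈ L.1}ᶜ) :=
    (isOpen_setOf_subset hF).inter (isClopen_setOf_mem x).compl.isOpen
  obtain ⟨g, _, ⟨L, hL, rfl⟩, h1, h2⟩ :=
    MulAction.IsTopologicallyTransitive.exists_smul_inter (M := G) (isOpen_setOf_subset hF')
      ⟨K', hK'⟩ hV ⟨K, hK, hxK⟩
  refine ⟨g, g • L, h1, h2, fun y hy => ?_⟩
  rw [mem_smul_iff]
  simpa [mul_assoc] using hL hy

/-- Containing `N` is a conjugation-invariant open condition, satisfied by `N` itself. It excludes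
avoiding some `x ∈ N`, an open condition that `⊥` satisfies when `x ≠ 1`. -/
theorem eq_bot_of_finite_of_normal [Infinite G] (N : Subgroup G) [Finite N] [N.Normal] :
    N = ⊥ := by
  rw [Subgroup.eq_bot_iff_forall]
  intro x hx
  by_contra hx1
  obtain ⟨g, L, -, h1, h2⟩ := exists_conj (F := ∅) (F' := (N : Set G)) (x := x) Set.finite_empty
    (Set.toFinite _) ⟨⊥, not_finiteIndex_of_finite _⟩ (Set.empty_subset _)
    (by simpa using hx1) ⟨N, not_finiteIndex_of_finite _⟩ subset_rfl
  apply h1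
  have := h2 (g⁻¹ * x * g) (by simpa using Subgroup.Normal.conj_mem ‹_› x hx g⁻¹)
  simpa [mul_assoc] using this

theorem not_noProperSubgroupMeetsAllConjClasses [Countable G] [Infinite G]
    (hG : ∀ s : G, ¬ (Subgroup.zpowers s).FiniteIndex) :
    ¬ NoProperSubgroupMeetsAllConjClasses G := by
  classical
  obtain ⟨x, hx⟩ := exists_ne (1 : G)
  -- The invariant of the recursion: it keeps `x` out of the subgroup generated by `F`, hence out of
  -- the increasing union.
  let P := {F : Finset G // ∃ K : SubInf G, (F : Set G) ⊆ K.1 ∧ x ∉ K.1}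
  have step (A : P) (s : G) : ∃ B : P, A.1 ⊆ B.1 ∧ ∃ k : G, k⁻¹ * s * k ∈ B.1 := by
    obtain ⟨F, K, hFK, hxK⟩ := A
    obtain ⟨g, L, h1, h2, h3⟩ := exists_conj (F' := {s}) F.finite_toSet (Set.finite_singleton s)
      K hFK hxK ⟨Subgroup.zpowers s, hG s⟩ (by simp)
    refine ⟨⟨insert (g * s * g⁻¹) F, L, ?_, h2⟩, Finset.subset_insert _ _, g⁻¹, by simp⟩
    rw [Finset.coe_insert, Set.insert_subset_iff]
    exact ⟨h3 s rfl, h1⟩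
  choose next hsub hmem using step
  obtain ⟨e, he⟩ := exists_surjective_nat G
  let P0 : P := ⟨∅, ⟨⊥, not_finiteIndex_of_finite _⟩, by simp, by simpa using hx⟩
  let seq : ℕ → P := fun n => Nat.rec P0 (fun n A => next A (e n)) n
  have hmono : Monotone fun n => Subgroup.closure ((seq n).1 : Set G) :=
    monotone_nat_of_le_succ fun n =>
      Subgroup.closure_mono (Finset.coe_subset.2 (hsub (seq n) (e n)))
  intro hX
  have htop := hX (⨆ n, Subgroup.closure ((seq n).1 : Set G)) fun g => by
    obtain ⟨n, rfl⟩ := he g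
    obtain ⟨k, hk⟩ := hmem (seq n) (e n)
    exact ⟨k, Subgroup.mem_iSup_of_mem (n + 1) (Subgroup.subset_closure hk)⟩
  have hxm : x ∈ ⨆ n, Subgroup.closure ((seq n).1 : Set G) := by rw [htop]; trivial
  obtain ⟨n, hn⟩ := (Subgroup.mem_iSup_of_directed hmono.directed_le).1 hxm
  obtain ⟨K, hK, hxK⟩ := (seq n).2
  exact hxK ((Subgroup.closure_le _).2 hK hn)

end IsTopologicallyTransitive

end SubInf

/-! ### Cyclic and virtually cyclic groups -/

theorem Subgroup.finiteIndex_zpowers_zpow {G : Type*} [Group G] {g : G}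
    (hg : (Subgroup.zpowers g).FiniteIndex) {j : ℤ} (hj : j ≠ 0) :
    (Subgroup.zpowers (g ^ j)).FiniteIndex := by
  have h1 : Subgroup.zpowers (g ^ j) =
      (Subgroup.zpowers (Multiplicative.ofAdd j)).map (zpowersHom G g) := by
    rw [MonoidHom.map_zpowers]; simp
  have h2 : (Subgroup.zpowers (Multiplicative.ofAdd j)).FiniteIndex := by
    have : (AddSubgroup.zmultiples j).FiniteIndex := ⟨by simpa [Int.index_zmultiples] using hj⟩
    rw [← AddSubgroup.finiteIndex_toSubgroup_iff] at this
    exact this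
  refine ⟨?_⟩
  rw [h1, Subgroup.index_map]
  refine mul_ne_zero (Subgroup.finiteIndex_of_le le_sup_left).index_ne_zero ?_
  have : (zpowersHom G g).range = Subgroup.zpowers g := by
    ext y; simp [Subgroup.mem_zpowers_iff, MonoidHom.mem_range]
  rw [this]
  exact hg.index_ne_zero

namespace SubInf

theorem subsingleton_of_isCyclic {G : Type*} [Group G] [IsCyclic G] : Subsingleton (SubInf G) := by
  obtain ⟨g, hg⟩ := IsCyclic.exists_generator (α := G)
  have hbot (K : SubInf G) : K.1 = ⊥ := by
    rw [Subgroup.eq_bot_iff_forall]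
    intro x hx
    obtain ⟨j, rfl⟩ := hg x
    by_contra hne
    have hj : j ≠ 0 := by rintro rfl; exact hne (zpow_zero g)
    have htop : Subgroup.zpowers g = ⊤ := (Subgroup.eq_top_iff' _).2 hg
    have := Subgroup.finiteIndex_zpowers_zpow (g := g) (by rw [htop]; infer_instance) hj
    exact K.2 (Subgroup.finiteIndex_of_le (Subgroup.zpowers_le.2 hx))
  exact ⟨fun K L => Subtype.ext ((hbot K).trans (hbot L).symm)⟩

theorem isTopologicallyTransitive_of_isCyclic {G : Type*} [Group G] [IsCyclic G] :
    MulAction.IsTopologicallyTransitive G (SubInf G) := by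
  have := subsingleton_of_isCyclic (G := G)
  refine ⟨fun {U V} _ ⟨K, hK⟩ _ ⟨L, hL⟩ => ⟨1, L, ⟨K, hK, Subsingleton.elim _ _⟩, hL⟩⟩

end SubInf

/-- The centralizer of an infinite cyclic normal subgroup of finite index is cyclic, provided `G`
has no nontrivial finite normal subgroup. -/
theorem Subgroup.isCyclic_centralizer_of_finiteIndex {G : Type*} [Group G] (E : Subgroup G)
    [E.Normal] [E.FiniteIndex] [IsCyclic E] [Infinite E]
    (hG : ∀ N : Subgroup G, N.Normal → Finite N → N = ⊥) :
    IsCyclic (Subgroup.centralizer (E : Set G)) := by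
  set C := Subgroup.centralizer (E : Set G) with hC
  have hE : ∀ a ∈ E, ∀ b ∈ E, a * b = b * a := fun a ha b hb =>
    congrArg Subtype.val (IsCyclic.isMulCommutative (α := E) |>.is_comm.comm ⟨a, ha⟩ ⟨b, hb⟩)
  have hEtf : ∀ a ∈ E, ∀ n : ℕ, n ≠ 0 → a ^ n = 1 → a = 1 := by
    intro a ha n hn h
    let φ : E ≃* Multiplicative ℤ := (intCyclicMulEquiv (G := E)).symm
    have h1 : φ ⟨a, ha⟩ ^ n = 1 := by
      rw [← map_pow, ← map_one φ]; congr 1; exact Subtype.ext h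
    have h2 : φ ⟨a, ha⟩ = 1 := by
      have h3 := congrArg Multiplicative.toAdd h1
      rw [toAdd_pow, toAdd_one, smul_eq_zero] at h3
      exact Multiplicative.toAdd.injective (h3.resolve_left hn)
    exact congrArg Subtype.val ((MulEquiv.map_eq_one_iff φ).1 h2)
  have hEZ : E.subgroupOf C ≤ Subgroup.center C := by
    intro a ha
    rw [Subgroup.mem_center_iff]
    intro c
    exact Subtype.ext (c.2 a ha).symm
  have : (Subgroup.center C).FiniteIndex := Subgroup.finiteIndex_of_le hEZ
  set n := (Subgroup.center C).index with hn
  have hn0 : n ≠ 0 := Subgroup.FiniteIndex.index_ne_zero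
  set m := E.index with hm
  have hm0 : m ≠ 0 := Subgroup.FiniteIndex.index_ne_zero
  have hpow (g : G) : g ^ m ∈ E := E.pow_index_mem g
  -- The centre of `C` has finite index, so the transfer `c ↦ c ^ n` is a homomorphism into it.
  -- Following it by the `m`-th power lands in the cyclic group `E`, and it remains to see that the
  -- kernel is trivial.
  let ψ : Subgroup.center C →* E :=
    { toFun := fun z => ⟨((z : C) : G) ^ m, hpow _⟩
      map_one' := by simp
      map_mul' := fun a b => Subtype.ext <| by
        have : Commute (((a : C) : G)) ((b : C) : G) :=
          congrArg Subtype.val (Subgroup.mem_center_iff.1 b.2 (a : C))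
        exact this.mul_pow m }
  let φ : C →* E := ψ.comp (MonoidHom.transferCenterPow C)
  have hφ (c : C) : (φ c : G) = ((c : G) ^ n) ^ m := rfl
  let N : Subgroup G := φ.ker.map C.subtype
  have hNmem (g : G) : g ∈ N ↔ g ∈ C ∧ (g ^ n) ^ m = 1 := by
    constructor
    · rintro ⟨c, hc, rfl⟩
      exact ⟨c.2, by rw [C.subtype_apply, ← hφ, (MonoidHom.mem_ker).1 hc]; rfl⟩
    · rintro ⟨hg, h⟩
      exact ⟨⟨g, hg⟩, Subtype.ext h, rfl⟩
  have hNn : N.Normal := ⟨fun a ha g => by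
    rw [hNmem] at ha ⊢
    refine ⟨(inferInstance : C.Normal).conj_mem a ha.1 g, ?_⟩
    rw [conj_pow, conj_pow, ha.2]; simp⟩
  -- Elements of `N` are torsion and `E` is torsion-free, so `N` embeds in the finite set `G ⧸ E`.
  have hNf : Finite N := by
    refine Finite.of_injective (fun x : N => ((x : G) : G ⧸ E)) fun x y hxy => ?_
    have h1 : (x : G)⁻¹ * y ∈ E := QuotientGroup.eq.1 hxy
    have h2 := (hNmem _).1 (N.mul_mem (N.inv_mem x.2) y.2)
    have h3 := hEtf _ h1 (n * m) (mul_ne_zero hn0 hm0) (by rw [pow_mul]; exact h2.2)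
    exact Subtype.ext (inv_mul_eq_one.1 h3)
  have hN := hG N hNn hNf
  have hinj : Function.Injective φ := by
    rw [← MonoidHom.ker_eq_bot_iff]
    exact (Subgroup.map_eq_bot_iff_of_injective _ C.subtype_injective).1 hN
  exact isCyclic_of_injective φ hinj

/-- The centralizer `C` of the normal core is infinite cyclic. If `C ≠ ⊤`, elements outside `C` are
involutions inverting its generator `u`, as in the infinite dihedral group. Transitivity then puts
`g` and a conjugate of `u * g` in one infinite-index subgroup, which thus contains a nontrivial
power of `u`. -/
theorem SubInf.isCyclic_of_finiteIndex_zpowers {G : Type*} [Group G] [Infinite G]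
    [MulAction.IsTopologicallyTransitive G (SubInf G)] {s : G}
    (hs : (Subgroup.zpowers s).FiniteIndex) : IsCyclic G := by
  set E := (Subgroup.zpowers s).normalCore with hE
  have hEinf : Infinite E := by
    by_contra h
    rw [not_infinite_iff_finite] at h
    exact SubInf.not_finiteIndex_of_finite E inferInstance
  have hEcyc : IsCyclic E :=
    isCyclic_of_injective _ (Subgroup.inclusion_injective (Subgroup.zpowers s).normalCore_le)
  have hCcyc := Subgroup.isCyclic_centralizer_of_finiteIndex E
    fun N _ _ => SubInf.eq_bot_of_finite_of_normal N
  set C := Subgroup.centralizer (E : Set G) with hC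
  have hEC : E ≤ C := fun a ha b hb =>
    congrArg Subtype.val (IsCyclic.isMulCommutative (α := E) |>.is_comm.comm ⟨b, hb⟩ ⟨a, ha⟩)
  obtain ⟨⟨t, htE⟩, ht⟩ := IsCyclic.exists_generator (α := E)
  have ht' : ∀ a ∈ E, ∃ i : ℤ, t ^ i = a := fun a ha => by
    obtain ⟨i, hi⟩ := ht ⟨a, ha⟩
    exact ⟨i, congrArg Subtype.val hi⟩
  obtain ⟨⟨u, huC⟩, hu⟩ := IsCyclic.exists_generator (α := C)
  have hu' : ∀ a ∈ C, ∃ i : ℤ, u ^ i = a := fun a ha => by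
    obtain ⟨i, hi⟩ := hu ⟨a, ha⟩
    exact ⟨i, congrArg Subtype.val hi⟩
  have hCz : C = Subgroup.zpowers u :=
    le_antisymm (fun a ha => hu' a ha) (Subgroup.zpowers_le.2 huC)
  have hzf : (Subgroup.zpowers u).FiniteIndex := hCz ▸ Subgroup.finiteIndex_of_le hEC
  have hinj : Function.Injective fun i : ℤ => u ^ i := by
    rw [injective_zpow_iff_not_isOfFinOrder]
    intro hfin
    have : Finite (Subgroup.zpowers u) := finite_zpowers.2 hfin
    exact SubInf.not_finiteIndex_of_finite _ hzf
  have hmemC (g : G) (h : g * t * g⁻¹ = t) : g ∈ C := fun a ha => by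
    obtain ⟨i, rfl⟩ := ht' a ha
    have : Commute g t := mul_inv_eq_iff_eq_mul.1 h
    exact (this.zpow_right i).symm
  obtain ⟨j, hj⟩ := hu' t (hEC htE)
  have hj0 : j ≠ 0 := by
    rintro rfl
    rw [zpow_zero] at hj
    have : E = ⊥ := (Subgroup.eq_bot_iff_forall _).2 fun a ha => by
      obtain ⟨i, rfl⟩ := ht' a ha
      rw [← hj, one_zpow]
    rw [this] at hEinf
    exact not_finite_iff_infinite.2 hEinf inferInstance
  have hconj (g : G) (hg : g ∉ C) : g * u * g⁻¹ = u⁻¹ := by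
    have hCn : C.Normal := inferInstance
    obtain ⟨a, ha⟩ := hu' _ (hCn.conj_mem u huC g)
    obtain ⟨b, hb⟩ := hu' _ (hCn.conj_mem u huC g⁻¹)
    have hab : a * b = 1 := by
      apply hinj
      change u ^ (a * b) = u ^ (1 : ℤ)
      rw [zpow_mul, ha, conj_zpow, hb]
      group
    rcases Int.isUnit_iff.1 (IsUnit.of_mul_eq_one b hab) with rfl | rfl
    · exact absurd (hmemC g (by rw [← hj, ← conj_zpow, ← ha, zpow_one])) hg
    · rw [← ha, zpow_neg_one]
  by_cases hCtop : C = ⊤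
  · exact ⟨u, fun x => hu' x (hCtop ▸ Subgroup.mem_top x)⟩
  obtain ⟨g, hg⟩ : ∃ g, g ∉ C := by
    by_contra! h
    exact hCtop ((Subgroup.eq_top_iff' _).2 h)
  have hconjz (g : G) (hg : g ∉ C) (i : ℤ) : g * u ^ i * g⁻¹ = u ^ (-i) := by
    rw [← conj_zpow, hconj g hg, inv_zpow, zpow_neg]
  -- `g * g` is a power of `u`, which `g` both inverts and commutes with.
  have hsq (g : G) (hg : g ∉ C) : g * g = 1 := by
    have h1 : g * g ∈ C := hmemC _ <| by
      have : g * g * t * (g * g)⁻¹ = g * (g * t * g⁻¹) * g⁻¹ := by group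
      rw [this, ← hj, hconjz g hg, hconjz g hg, neg_neg]
    obtain ⟨i, hi⟩ := hu' _ h1
    have h2 : u ^ i = u ^ (-i) := by
      rw [← hconjz g hg i, hi]; group
    have : i = -i := hinj h2
    have hi0 : i = 0 := by omega
    rw [← hi, hi0, zpow_zero]
  have hfinz (g : G) (hg : g ∉ C) : ¬ (Subgroup.zpowers g).FiniteIndex := by
    have : Finite (Subgroup.zpowers g) := finite_zpowers.2
      (isOfFinOrder_iff_pow_eq_one.2 ⟨2, by norm_num, by rw [sq, hsq g hg]⟩)
    exact SubInf.not_finiteIndex_of_finite _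
  have hug : u * g ∉ C := fun h => hg ((Subgroup.mul_mem_cancel_left C huC).1 h)
  have hu_g : u ∉ Subgroup.zpowers g := fun h =>
    hfinz g hg (Subgroup.finiteIndex_of_le (Subgroup.zpowers_le.2 h))
  obtain ⟨k, L, hgL, -, hL⟩ := SubInf.exists_conj (F := {g}) (F' := {u * g}) (x := u)
    (Set.finite_singleton _) (Set.finite_singleton _) ⟨Subgroup.zpowers g, hfinz g hg⟩ (by simp)
    hu_g ⟨Subgroup.zpowers (u * g), hfinz _ hug⟩ (by simp)
  replace hgL : g ∈ L.1 := hgL rfl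
  replace hL := hL _ rfl
  have hgu (i : ℤ) : g * u ^ i = u ^ (-i) * g := by rw [← hconjz g hg i]; group
  -- Conjugation preserves the parity of the exponent `r` in `u ^ r * g`; starting from `r = 1` it
  -- stays odd, hence nonzero.
  have hodd : ∃ m : ℤ, m ≠ 0 ∧ k * (u * g) * k⁻¹ = u ^ m * g := by
    by_cases hk : k ∈ C
    · obtain ⟨i, rfl⟩ := hu' k hk
      refine ⟨i + 1 + i, by omega, ?_⟩
      calc u ^ i * (u * g) * (u ^ i)⁻¹ = u ^ (i + 1) * (g * u ^ (-i)) := by group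
        _ = u ^ (i + 1 + i) * g := by rw [hgu]; group
    · have hkg : k * g⁻¹ ∈ C := hmemC _ <| by
        have : k * g⁻¹ * t * (k * g⁻¹)⁻¹ = k * (g⁻¹ * t * g⁻¹⁻¹) * k⁻¹ := by group
        rw [this, ← hj, hconjz _ fun h => hg (C.inv_mem_iff.1 h), hconjz k hk, neg_neg]
      obtain ⟨i, hi⟩ := hu' _ hkg
      obtain rfl : k = u ^ i * g := by rw [hi]; group
      refine ⟨i - 1 + i, by omega, ?_⟩
      calc u ^ i * g * (u * g) * (u ^ i * g)⁻¹ = u ^ i * (g * u ^ (1 : ℤ)) * u ^ (-i) := by group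
        _ = u ^ (i - 1) * (g * u ^ (-i)) := by rw [hgu]; group
        _ = u ^ (i - 1 + i) * g := by rw [hgu]; group
  obtain ⟨m, hm, hkm⟩ := hodd
  rw [hkm] at hL
  have hmL : u ^ m ∈ L.1 := (Subgroup.mul_mem_cancel_right _ hgL).1 hL
  have := Subgroup.finiteIndex_zpowers_zpow hzf hm
  exact absurd (Subgroup.finiteIndex_of_le (Subgroup.zpowers_le.2 hmL)) L.2

theorem NoProperSubgroupMeetsAllConjClasses.isTopologicallyTransitive_iff {G : Type*} [Group G]
    [Countable G] [Infinite G] (hG : NoProperSubgroupMeetsAllConjClasses G) :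
    MulAction.IsTopologicallyTransitive G (SubInf G) ↔ Nonempty (G ≃* Multiplicative ℤ) := by
  constructor
  · intro h
    obtain ⟨s, hs⟩ : ∃ s : G, (Subgroup.zpowers s).FiniteIndex := by
      by_contra! hs
      exact SubInf.not_noProperSubgroupMeetsAllConjClasses hs hG
    have := SubInf.isCyclic_of_finiteIndex_zpowers hs
    exact ⟨(intCyclicMulEquiv (G := G)).symm⟩
  · rintro ⟨e⟩
    have : IsCyclic G := isCyclic_of_injective e.toMonoidHom e.injective
    exact SubInf.isTopologicallyTransitive_of_isCyclic

theorem corollary3p10 (G : Type*) [Group G] [Countable G] [Infinite G] :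
    (IsInvariablyGenerated G →
      (MulAction.IsTopologicallyTransitive G (SubInf G) ↔ Nonempty (G ≃* Multiplicative ℤ))) ∧
    (IsVirtuallySolvable G →
      (MulAction.IsTopologicallyTransitive G (SubInf G) ↔
        Nonempty (G ≃* Multiplicative ℤ))) :=
  ⟨fun h =>
    (NoProperSubgroupMeetsAllConjClasses.of_isInvariablyGenerated h).isTopologicallyTransitive_iff,
  fun h =>
    (NoProperSubgroupMeetsAllConjClasses.of_isVirtuallySolvable h).isTopologicallyTransitive_iff⟩
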